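/- Let $N\ge 0$ be an integer and let $$g(t)=\sum_{k=1}^N\frac{a_k}{t-iw_k},\qquad a_k,w_k\in\mathbb C,\quad a_k\neq 0,\quad \operatorname{Re}w_k\neq 0,$$ so that $g\in L^2(\mathbb R)$ is rational without multiple poles, and let $0<\alpha\le 1$. Let $\mathcal G(g;\alpha,1)=\{e^{2\pi i n t}g(t-\alpha m):\ m,n\in\mathbb Z\}$; this system is called a frame in $L^2(\mathbb R)$ if there are constants $A>0$ and $B<\infty$ with $$A\|f\|^2\le\sum_{m,n\in\mathbb Z}\left|\int_{\mathbb R} f(t)\,\overline{e^{2\pi i n t}g(t-\alpha m)}\,dt\right|^2\le B\|f\|^2\qquad\text{for all } f\in L^2(\mathbb R).$$ For $1\le k\le N$ and $0\le s\le N-1$ put $$A_{k,s}=(-1)^s\sum_{\substack{j_1<j_2<\dots<j_s\\ j_l\ne k}}e^{\frac{2\pi}{\alpha}(w_{j_1}+\dots+w_{j_s})},\qquad m_s(\xi)=\sum_{k=1}^N a_kA_{k,s}e^{2\pi\xi w_k},$$ where the sum defining $A_{k,s}$ runs over all $s$-element sets of indices in $\{1,\dots,N\}\setminus\{k\}$ (so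 $A_{k,0}=1$). Then the following are equivalent: (i) $\mathcal G(g;\alpha,1)$ is a frame in $L^2(\mathbb R)$; (ii) there are constants $c,C>0$ such that for all $G\in L^2(\mathbb R)$ $$c\,\|G\|_{L^2(\mathbb R)}^2\le\int_0^{1/\alpha}\sum_{n\in\mathbb Z}\left|\sum_{s=0}^{N-1}G\!\left(\xi+n+\frac s\alpha\right)m_s(\xi)\right|^2d\xi\le C\,\|G\|_{L^2(\mathbb R)}^2 .$$ -/

import Mathlib

open MeasureTheory
open scoped ENNReal

noncomputable section

namespace RationalGabor

/-- A family `φ` of vectors of a complex Hilbert space is a frame if, for some `A > 0` and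
`B < ∞`, `A ‖f‖² ≤ ∑ |⟨f, φ i⟩|² ≤ B ‖f‖²` for all `f`. Since Mathlib's inner product is
conjugate-linear in the first argument, the `⟨f, φ i⟩` of the text is `inner ℂ (φ i) f`. -/
def IsFrame {ι H : Type*} [NormedAddCommGroup H] [InnerProductSpace ℂ H] (φ : ι → H) : Prop :=
  ∃ A B : ℝ, 0 < A ∧ ∀ f : H,
    Summable (fun i => ‖inner ℂ (φ i) f‖ ^ 2) ∧
    A * ‖f‖ ^ 2 ≤ ∑' i, ‖inner ℂ (φ i) f‖ ^ 2 ∧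
    ∑' i, ‖inner ℂ (φ i) f‖ ^ 2 ≤ B * ‖f‖ ^ 2

/-- The time-frequency shift `(π_{x,y} g)(t) = e^{2πiyt} g(t - x)`. -/
def timeFreqShift (x y : ℝ) (g : ℝ → ℂ) (t : ℝ) : ℂ :=
  Complex.exp (2 * Real.pi * Complex.I * y * t) * g (t - x)

theorem memLp_timeFreqShift {g : ℝ → ℂ} (hg : MemLp g 2 volume) (x y : ℝ) :
    MemLp (timeFreqShift x y g) 2 volume := by
  have h1 : MemLp (fun t => g (t - x)) 2 volume :=
    hg.comp_measurePreserving (measurePreserving_sub_right volume x)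
  have hc : Continuous fun t : ℝ => Complex.exp (2 * Real.pi * Complex.I * y * t) := by
    fun_prop
  refine h1.of_le (hc.aestronglyMeasurable.mul h1.1) (Filter.Eventually.of_forall fun t => ?_)
  have h2 : ‖Complex.exp (2 * Real.pi * Complex.I * y * t)‖ = 1 := by
    rw [Complex.norm_exp]; simp
  simp [timeFreqShift, h2]

/-- The Gabor system `{π_{αm, βn} g : m, n ∈ ℤ}` as a family in `L²(ℝ)`. -/
def gaborSystem (g : ℝ → ℂ) (hg : MemLp g 2 volume) (α β : ℝ) :
    ℤ × ℤ → Lp ℂ 2 (volume : Measure ℝ) :=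
  fun p => (memLp_timeFreqShift hg (α * p.1) (β * p.2)).toLp

/-- The rational window `g(t) = ∑ₖ aₖ / (t - i wₖ)`. -/
def window {N : ℕ} (a w : Fin N → ℂ) (t : ℝ) : ℂ :=
  ∑ k, a k / ((t : ℂ) - Complex.I * w k)

theorem memLp_window {N : ℕ} (a w : Fin N → ℂ) (hw : ∀ k, (w k).re ≠ 0) :
    MemLp (window a w) 2 volume := by
  refine memLp_finsetSum _ fun k _ => ?_
  have hne : ∀ t : ℝ, (t : ℂ) - Complex.I * w k ≠ 0 := fun t h => hw k (by
    have := congrArg Complex.im h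
    simpa using this)
  have hc : Continuous fun t : ℝ => a k / ((t : ℂ) - Complex.I * w k) :=
    continuous_const.div (by fun_prop) hne
  rw [memLp_two_iff_integrable_sq_norm hc.aestronglyMeasurable]
  have h0 : Integrable (fun t : ℝ => (1 + t ^ 2)⁻¹) volume := integrable_inv_one_add_sq
  have h1 : Integrable (fun t : ℝ => (1 + (t / (w k).re) ^ 2)⁻¹) volume := h0.comp_div (hw k)
  have h2 := ((h1.comp_add_right (w k).im).const_mul (‖a k‖ ^ 2 / (w k).re ^ 2))
  refine h2.congr (Filter.Eventually.of_forall fun t => ?_)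
  have hr := hw k
  have h3 : ‖(t : ℂ) - Complex.I * w k‖ ^ 2 = (t + (w k).im) ^ 2 + (w k).re ^ 2 := by
    rw [Complex.sq_norm, Complex.normSq_apply]
    simp
    ring
  have h4 : (t + (w k).im) ^ 2 + (w k).re ^ 2 ≠ 0 := by positivity
  have h5 : 1 + ((t + (w k).im) / (w k).re) ^ 2 ≠ 0 := by positivity
  simp only [norm_div, div_pow, h3]
  field_simp
  ring

/-- `A_{k,s} = (-1)^s ∑ exp ((2π/α) (w_{j₁} + ⋯ + w_{jₛ}))`, the sum being over the `s`-element
sets `{j₁ < ⋯ < jₛ}` of indices different from `k`. -/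
def coeffA {N : ℕ} (α : ℝ) (w : Fin N → ℂ) (k : Fin N) (s : ℕ) : ℂ :=
  (-1) ^ s * ∑ S ∈ (Finset.univ.erase k).powersetCard s,
    Complex.exp (2 * Real.pi / α * ∑ j ∈ S, w j)

/-- The multipliers `m_s(ξ) = ∑ₖ aₖ A_{k,s} e^{2πξwₖ}`. -/
def multiplier {N : ℕ} (α : ℝ) (a w : Fin N → ℂ) (s : ℕ) (ξ : ℝ) : ℂ :=
  ∑ k, a k * coeffA α w k s * Complex.exp (2 * Real.pi * ξ * w k)

/-- `∫₀^{1/α} ∑_{n ∈ ℤ} |∑_{s=0}^{N-1} G(ξ + n + s/α) m_s(ξ)|² dξ`, with values in `[0, ∞]`. -/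
def criterionForm {N : ℕ} (α : ℝ) (a w : Fin N → ℂ) (G : ℝ → ℂ) : ℝ≥0∞ :=
  ∫⁻ ξ in Set.Ioo (0 : ℝ) (1 / α), ∑' n : ℤ,
    ‖∑ s ∈ Finset.range N, G (ξ + n + s / α) * multiplier α a w s ξ‖ₑ ^ 2

end RationalGabor

end

namespace RationalGabor

open FourierTransform Complex ComplexConjugate

/-! The `symbol` Φ is α-periodic and, since no `w l` is imaginary, bounded and bounded away from
zero. Multiplying the window by Φ removes its infinite Fourier support: 1 - e^{2πwₖ/α}e^{2πit/α}
over the k-th pole is, up to a constant, the inverse transform of an exponential cut to (0, 1/α],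
and the other factors expand in powers of e^{2πit/α}, which translate by s/α with coefficients
`coeffA`. So Φg = -2πi 𝓕⁻ `bump` (`integral_exp_mul_bump`).

By periodicity Φ commutes with the shifts in the system. Writing f = Φ̄f', the frame coefficients of
f become pairings of 𝓕f' with modulated translates of `bump`. For fixed n, folding onto (0, 1/α]
makes them Fourier integrals in m (`integral_mul_modBump`). Parseval in m then gives the criterion
form at G, the conjugate of 𝓕f', times (2π)²/α. As f ↦ G distorts norms by bounded factors only,
both two-sided bounds are equivalent. -/

/-! ### Inverse Fourier transform in L² and Parseval on an interval -/

/-- Both sides agree when tested against Schwartz functions, because the transform can be moved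
across the pairing, and L² embeds injectively in the tempered distributions. -/
theorem fourierInv_toLp {u v : ℝ → ℂ} (hu : Integrable u) (hu2 : MemLp u 2 volume)
    (hv : MemLp v 2 volume) (huv : ∀ t, 𝓕⁻ u t = v t) :
    𝓕⁻ (hu2.toLp u) = hv.toLp v := by
  have key : Lp.toTemperedDistributionCLM ℂ volume 2 (𝓕⁻ (hu2.toLp u)) =
      Lp.toTemperedDistributionCLM ℂ volume 2 (hv.toLp v) := by
    simp only [Lp.toTemperedDistributionCLM_apply]
    rw [← Lp.fourierInv_toTemperedDistribution_eq]
    ext φ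
    rw [TemperedDistribution.fourierInv_apply, Lp.toTemperedDistribution_apply,
      Lp.toTemperedDistribution_apply]
    have h1 : ∫ x, (𝓕⁻ φ) x • (hu2.toLp u) x = ∫ x, 𝓕⁻ (φ : ℝ → ℂ) x • u x := by
      refine integral_congr_ae ?_
      filter_upwards [hu2.coeFn_toLp] with x hx
      rw [hx, SchwartzMap.fourierInv_coe]
    have h2 : ∫ x, φ x • (hv.toLp v) x = ∫ x, φ x • 𝓕⁻ u x := by
      refine integral_congr_ae ?_
      filter_upwards [hv.coeFn_toLp] with x hx
      rw [hx, huv]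
    rw [h1, h2]
    have hc : Continuous fun p : ℝ × ℝ => (-innerₗ ℝ) p.1 p.2 :=
      (continuous_inner (𝕜 := ℝ) (E := ℝ)).neg
    have e1 : ∀ x, 𝓕⁻ (φ : ℝ → ℂ) x =
        VectorFourier.fourierIntegral Real.fourierChar volume (-innerₗ ℝ) φ x := fun x => by
      simp [Real.fourierInv_eq, VectorFourier.fourierIntegral]
    have e2 : ∀ x, 𝓕⁻ u x =
        VectorFourier.fourierIntegral Real.fourierChar volume (-innerₗ ℝ).flip u x := fun x => by
      simp [Real.fourierInv_eq, VectorFourier.fourierIntegral, mul_comm]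
    simp_rw [e1, e2]
    exact VectorFourier.integral_fourierIntegral_smul_eq_flip (L := -innerₗ ℝ)
      Real.continuous_fourierChar hc φ.integrable hu (μ := volume) (ν := volume)
  have hk := LinearMap.ker_eq_bot.1
    (Lp.ker_toTemperedDistributionCLM_eq_bot (F := ℂ) (μ := (volume : Measure ℝ)) (p := 2))
  exact hk key

theorem tsum_enorm_sq_fourierIntegral {T : ℝ} (hT : 0 < T) {H : ℝ → ℂ}
    (hH : MemLp H 2 (volume.restrict (Set.Ioc 0 T))) :
    ∑' m : ℤ, ‖∫ x in Set.Ioc 0 T, exp (-(2 * Real.pi * I * m * x / T)) * H x‖ₑ ^ 2 =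
      ENNReal.ofReal T * ∫⁻ x in Set.Ioo 0 T, ‖H x‖ₑ ^ 2 := by
  have hs := hasSum_sq_fourierCoeffOn hT hH
  have hc : ∀ m : ℤ, ∫ x in Set.Ioc 0 T, exp (-(2 * Real.pi * I * m * x / T)) * H x =
      T * fourierCoeffOn hT H m := by
    -- The Fourier coefficient carries a factor 1/T; squaring T against Parseval's 1/T leaves the
    -- single T of the statement.
    intro m
    rw [fourierCoeffOn_eq_integral, intervalIntegral.integral_of_le hT.le, sub_zero,
      Complex.real_smul, ← mul_assoc, ← Complex.ofReal_mul, mul_one_div_cancel hT.ne',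
      Complex.ofReal_one, one_mul]
    congr 1 with x
    rw [fourier_coe_apply, smul_eq_mul]
    congr 2
    push_cast
    ring
  have hint : Integrable (fun x => ‖H x‖ ^ 2) (volume.restrict (Set.Ioc 0 T)) :=
    (memLp_two_iff_integrable_sq_norm hH.1).1 hH
  have hl : ∫⁻ x in Set.Ioo 0 T, ‖H x‖ₑ ^ 2 =
      ENNReal.ofReal (∫ x in (0 : ℝ)..T, ‖H x‖ ^ 2) := by
    rw [intervalIntegral.integral_of_le hT.le,
      ofReal_integral_eq_lintegral_ofReal hint (Filter.Eventually.of_forall fun _ => sq_nonneg _),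
      Measure.restrict_congr_set Ioo_ae_eq_Ioc]
    congr 1 with x
    rw [ENNReal.ofReal_pow (norm_nonneg _), ofReal_norm]
  have he : ∀ m : ℤ, ‖(T : ℂ) * fourierCoeffOn hT H m‖ₑ ^ 2 =
      ENNReal.ofReal (T ^ 2 * ‖fourierCoeffOn hT H m‖ ^ 2) := by
    intro m
    rw [← ofReal_norm, ← ENNReal.ofReal_pow (norm_nonneg _), norm_mul, mul_pow]
    simp
  simp_rw [hc, he]
  rw [← ENNReal.ofReal_tsum_of_nonneg (fun m => by positivity) (hs.summable.mul_left _),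
    tsum_mul_left, hs.tsum_eq, hl, ← ENNReal.ofReal_mul hT.le]
  congr 1
  rw [sub_zero, smul_eq_mul]
  field_simp

/-! ### The periodic symbol and its compactly supported counterpart -/

theorem sum_coeffA_mul_pow {N : ℕ} (α : ℝ) (w : Fin N → ℂ) (k : Fin N) (ζ : ℂ) :
    ∑ s ∈ Finset.range N, coeffA α w k s * ζ ^ s =
      ∏ l ∈ Finset.univ.erase k, (1 - exp (2 * Real.pi / α * w l) * ζ) := by
  -- Subsets of the other N - 1 indices have sizes 0, …, N - 1, exactly `range N`; N ≥ 1 because `k`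
  -- exists.
  have hN : (Finset.univ.erase k).card + 1 = N := by
    simp [Finset.card_erase_of_mem, Nat.sub_add_cancel k.pos]
  simp_rw [sub_eq_add_neg]
  rw [Finset.prod_one_add, Finset.sum_powerset, hN]
  refine Finset.sum_congr rfl fun s _ => ?_
  rw [coeffA, mul_assoc, Finset.sum_mul, Finset.mul_sum]
  refine Finset.sum_congr rfl fun S hS => ?_
  have hcard : S.card = s := (Finset.mem_powersetCard.1 hS).2
  rw [Finset.prod_neg, hcard, Finset.prod_mul_distrib, Finset.prod_const, hcard, Finset.mul_sum,
    Complex.exp_sum]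

/-- The trigonometric polynomial `Φ(t) = ∏ₗ (1 - e^{2πwₗ/α} e^{2πit/α})`, whose product with the
window has a compactly supported Fourier transform. -/
noncomputable def symbol {N : ℕ} (α : ℝ) (w : Fin N → ℂ) (t : ℝ) : ℂ :=
  ∏ l, (1 - exp (2 * Real.pi / α * w l) * exp (2 * Real.pi * I * t / α))

/-- The compactly supported function equal to `m_s(ξ - s/α)` on `(s/α, (s+1)/α]`, `0 ≤ s < N`. -/
noncomputable def bump {N : ℕ} (α : ℝ) (a w : Fin N → ℂ) (ξ : ℝ) : ℂ :=
  ∑ s ∈ Finset.range N, (Set.Ioc 0 (1 / α)).indicator (multiplier α a w s) (ξ - s / α)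

theorem continuous_multiplier {N : ℕ} (α : ℝ) (a w : Fin N → ℂ) (s : ℕ) :
    Continuous (multiplier α a w s) := by
  unfold multiplier
  fun_prop

theorem memLp_indicator_multiplier {N : ℕ} (α : ℝ) (a w : Fin N → ℂ) (s : ℕ) (p : ℝ≥0∞) :
    MemLp ((Set.Ioc 0 (1 / α)).indicator (multiplier α a w s)) p volume := by
  rw [memLp_indicator_iff_restrict measurableSet_Ioc]
  have hc := (continuous_multiplier α a w s)
  obtain ⟨C, hC⟩ := (isCompact_Icc (a := (0 : ℝ)) (b := 1 / α)).exists_bound_of_continuousOn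
    hc.continuousOn
  refine MemLp.of_bound hc.aestronglyMeasurable C ?_
  filter_upwards [ae_restrict_mem measurableSet_Ioc] with x hx
  exact hC x ⟨hx.1.le, hx.2⟩

theorem memLp_bump {N : ℕ} (α : ℝ) (a w : Fin N → ℂ) (p : ℝ≥0∞) :
    MemLp (bump α a w) p volume := by
  refine memLp_finsetSum _ fun s _ => ?_
  exact (memLp_indicator_multiplier α a w s p).comp_measurePreserving
    (measurePreserving_sub_right volume (s / α : ℝ))

theorem continuous_symbol {N : ℕ} (α : ℝ) (w : Fin N → ℂ) : Continuous (symbol α w) := by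
  unfold symbol
  fun_prop

theorem symbol_sub_mul {N : ℕ} {α : ℝ} (hα : α ≠ 0) (w : Fin N → ℂ) (t : ℝ) (m : ℤ) :
    symbol α w (t - α * m) = symbol α w t := by
  have : exp (2 * Real.pi * I * (t - α * m : ℝ) / α) = exp (2 * Real.pi * I * t / α) := by
    rw [← Complex.exp_periodic.sub_int_mul_eq m (x := 2 * Real.pi * I * t / α)]
    congr 1
    have : (α : ℂ) ≠ 0 := by exact_mod_cast hα
    push_cast
    field_simp
  simp only [symbol, this]

/-- In each factor 1 - z the modulus of z is e^{2π Re w/α}, independent of t and different from 1,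
so the triangle inequalities bound the factor on both sides. -/
theorem exists_symbol_bounds {N : ℕ} {α : ℝ} (hα : α ≠ 0) {w : Fin N → ℂ}
    (hw : ∀ k, (w k).re ≠ 0) :
    ∃ c C : ℝ, 0 < c ∧ 0 < C ∧ ∀ t, c ≤ ‖symbol α w t‖ ∧ ‖symbol α w t‖ ≤ C := by
  have hn : ∀ l (t : ℝ), ‖exp (2 * Real.pi / α * w l) * exp (2 * Real.pi * I * t / α)‖ =
      Real.exp (2 * Real.pi / α * (w l).re) := by
    intro l t
    have h1 : ((2 * Real.pi / α * w l : ℂ)).re = 2 * Real.pi / α * (w l).re := by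
      rw [show (2 * Real.pi / α * w l : ℂ) = ((2 * Real.pi / α : ℝ) : ℂ) * w l by push_cast; ring,
        Complex.re_ofReal_mul]
    have h2 : ((2 * Real.pi * I * t / α : ℂ)).re = 0 := by
      rw [show (2 * Real.pi * I * t / α : ℂ) = ((2 * Real.pi * t / α : ℝ) : ℂ) * I by
        push_cast; ring, Complex.re_ofReal_mul]
      simp
    rw [norm_mul, Complex.norm_exp, Complex.norm_exp, h1, h2, Real.exp_zero, mul_one]
  have hne : ∀ l, Real.exp (2 * Real.pi / α * (w l).re) ≠ 1 := by
    intro l h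
    rw [Real.exp_eq_one_iff] at h
    exact (mul_ne_zero (div_ne_zero (by positivity) hα) (hw l)) h
  refine ⟨∏ l, |1 - Real.exp (2 * Real.pi / α * (w l).re)|,
    ∏ l, (1 + Real.exp (2 * Real.pi / α * (w l).re)),
    Finset.prod_pos fun l _ => abs_pos.2 (sub_ne_zero.2 (hne l).symm),
    Finset.prod_pos fun l _ => by positivity, fun t => ?_⟩
  rw [symbol, norm_prod]
  constructor
  · refine Finset.prod_le_prod (fun _ _ => abs_nonneg _) fun l _ => ?_
    have := abs_norm_sub_norm_le (1 : ℂ)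
      (exp (2 * Real.pi / α * w l) * exp (2 * Real.pi * I * t / α))
    rwa [hn, norm_one] at this
  · refine Finset.prod_le_prod (fun _ _ => norm_nonneg _) fun l _ => ?_
    have := norm_sub_le (1 : ℂ)
      (exp (2 * Real.pi / α * w l) * exp (2 * Real.pi * I * t / α))
    rwa [hn, norm_one] at this

/-! ### Fourier representation of symbol times window -/

theorem integral_exp_mul_indicator_multiplier_sub {N : ℕ} {α : ℝ} (hα : 0 < α) (a w : Fin N → ℂ)
    (hw : ∀ k, (w k).re ≠ 0) (s : ℕ) (t : ℝ) :
    (∫ ξ : ℝ, exp (2 * Real.pi * I * ξ * t) *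
        (Set.Ioc 0 (1 / α)).indicator (multiplier α a w s) (ξ - s / α)) =
      ∑ k, a k * (coeffA α w k s * exp (2 * Real.pi * I * t / α) ^ s) *
        ((exp (2 * Real.pi / α * w k) * exp (2 * Real.pi * I * t / α) - 1) /
          (2 * Real.pi * (w k + I * t))) := by
  have hα' : (α : ℂ) ≠ 0 := by exact_mod_cast hα.ne'
  have hpi : (Real.pi : ℂ) ≠ 0 := by exact_mod_cast Real.pi_ne_zero
  have hne : ∀ k, w k + I * t ≠ 0 := fun k h => hw k (by
    have := congrArg Complex.re h
    simpa using this)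
  have h1 := integral_sub_right_eq_self (μ := (volume : Measure ℝ))
    (fun ξ : ℝ => exp (2 * Real.pi * I * (ξ + s / α) * t) *
      (Set.Ioc 0 (1 / α)).indicator (multiplier α a w s) ξ) (s / α : ℝ)
  have h2 : ∀ ξ : ℝ, exp (2 * Real.pi * I * ξ * t) *
        (Set.Ioc 0 (1 / α)).indicator (multiplier α a w s) (ξ - s / α) =
      exp (2 * Real.pi * I * ((ξ - s / α : ℝ) + s / α) * t) *
        (Set.Ioc 0 (1 / α)).indicator (multiplier α a w s) (ξ - s / α) := fun ξ => by
    push_cast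
    rw [sub_add_cancel]
  simp_rw [h2]
  rw [h1]
  have h3 : ∀ ξ : ℝ, exp (2 * Real.pi * I * (ξ + s / α) * t) *
        (Set.Ioc 0 (1 / α)).indicator (multiplier α a w s) ξ =
      (Set.Ioc 0 (1 / α)).indicator (fun ξ : ℝ => ∑ k, a k * (coeffA α w k s *
        exp (2 * Real.pi * I * t / α) ^ s) * exp (2 * Real.pi * (w k + I * t) * ξ)) ξ := fun ξ => by
    rw [← Set.indicator_mul_right (Set.Ioc 0 (1 / α))
      (fun ξ : ℝ => exp (2 * Real.pi * I * (ξ + s / α) * t))]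
    congr 1 with ξ
    rw [multiplier, Finset.mul_sum]
    refine Finset.sum_congr rfl fun k _ => ?_
    rw [← Complex.exp_nat_mul]
    have : exp (2 * Real.pi * I * (ξ + s / α) * t) * exp (2 * Real.pi * ξ * w k) =
        exp (s * (2 * Real.pi * I * t / α)) * exp (2 * Real.pi * (w k + I * t) * ξ) := by
      rw [← Complex.exp_add, ← Complex.exp_add]
      congr 1
      ring
    linear_combination a k * coeffA α w k s * this
  simp_rw [h3]
  rw [integral_indicator measurableSet_Ioc,
    ← intervalIntegral.integral_of_le (by positivity : (0 : ℝ) ≤ 1 / α),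
    intervalIntegral.integral_finsetSum fun k _ => (by fun_prop : Continuous _).intervalIntegrable _ _]
  refine Finset.sum_congr rfl fun k _ => ?_
  rw [intervalIntegral.integral_const_mul, integral_exp_mul_complex
    (mul_ne_zero (mul_ne_zero two_ne_zero hpi) (hne k)), ← Complex.exp_add]
  congr 3
  · congr 1
    push_cast
    field_simp
  · simp

/-- Summing over s rebuilds the factors of the symbol with l ≠ k; the missing k-th factor is the
endpoint difference from integrating the exponential. -/
theorem integral_exp_mul_bump {N : ℕ} {α : ℝ} (hα : 0 < α) (a w : Fin N → ℂ)
    (hw : ∀ k, (w k).re ≠ 0) (t : ℝ) :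
    -(2 * Real.pi * I) * ∫ ξ : ℝ, exp (2 * Real.pi * I * ξ * t) * bump α a w ξ =
      symbol α w t * window a w t := by
  have hpi : (Real.pi : ℂ) ≠ 0 := by exact_mod_cast Real.pi_ne_zero
  have hint : ∀ s : ℕ, Integrable (fun ξ : ℝ => exp (2 * Real.pi * I * ξ * t) *
      (Set.Ioc 0 (1 / α)).indicator (multiplier α a w s) (ξ - s / α)) := fun s => by
    have h1 : Integrable (fun ξ : ℝ =>
        (Set.Ioc 0 (1 / α)).indicator (multiplier α a w s) (ξ - s / α)) :=
      (memLp_one_iff_integrable.1 (memLp_indicator_multiplier α a w s 1)).comp_sub_right (s / α : ℝ)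
    refine h1.bdd_mul (c := 1) (by fun_prop : Continuous _).aestronglyMeasurable
      (Filter.Eventually.of_forall fun ξ => ?_)
    rw [Complex.norm_exp]
    simp
  simp_rw [bump, Finset.mul_sum]
  rw [integral_finsetSum _ fun s _ => hint s]
  simp_rw [integral_exp_mul_indicator_multiplier_sub hα a w hw]
  rw [Finset.sum_comm, window, Finset.mul_sum, Finset.mul_sum]
  refine Finset.sum_congr rfl fun k _ => ?_
  have hne : w k + I * t ≠ 0 := fun h => hw k (by
    have := congrArg Complex.re h
    simpa using this)
  have hne' : (t : ℂ) - I * w k ≠ 0 := by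
    have : (t : ℂ) - I * w k = -I * (w k + I * t) := by
      linear_combination (t : ℂ) * Complex.I_sq
    rw [this]
    exact mul_ne_zero (neg_ne_zero.2 I_ne_zero) hne
  have hΦ : symbol α w t = (1 - exp (2 * Real.pi / α * w k) * exp (2 * Real.pi * I * t / α)) *
      ∑ s ∈ Finset.range N, coeffA α w k s * exp (2 * Real.pi * I * t / α) ^ s := by
    rw [sum_coeffA_mul_pow, symbol, Finset.mul_prod_erase Finset.univ
      (fun l => 1 - exp (2 * Real.pi / α * w l) * exp (2 * Real.pi * I * t / α))
      (Finset.mem_univ k)]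
  rw [← Finset.sum_mul, ← Finset.mul_sum, hΦ]
  generalize ∑ s ∈ Finset.range N, coeffA α w k s * exp (2 * Real.pi * I * t / α) ^ s = S
  generalize exp (2 * Real.pi / α * w k) * exp (2 * Real.pi * I * t / α) = E
  field_simp
  linear_combination a k * S * w k * (E - 1) * Complex.I_sq

/-- The inverse Fourier transform of `modBump α a w m n` is, up to the factor `-2πi`, the product
of the symbol with the time-frequency shift of the window by `(αm, n)`. -/
noncomputable def modBump {N : ℕ} (α : ℝ) (a w : Fin N → ℂ) (p : ℤ × ℤ) (ξ : ℝ) : ℂ :=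
  exp (-(2 * Real.pi * I * (α * p.1) * (ξ - p.2))) * bump α a w (ξ - p.2)

theorem memLp_modBump {N : ℕ} (α : ℝ) (a w : Fin N → ℂ) (p : ℤ × ℤ) (q : ℝ≥0∞) :
    MemLp (modBump α a w p) q volume := by
  have h1 : MemLp (fun ξ => bump α a w (ξ - p.2)) q volume :=
    (memLp_bump α a w q).comp_measurePreserving (measurePreserving_sub_right volume (p.2 : ℝ))
  have hc : Continuous fun ξ : ℝ => exp (-(2 * Real.pi * I * (α * p.1) * (ξ - p.2))) := by
    fun_prop
  refine h1.of_le (hc.aestronglyMeasurable.mul h1.1) (Filter.Eventually.of_forall fun t => ?_)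
  have h2 : ‖exp (-(2 * Real.pi * I * (α * p.1) * (t - p.2)))‖ = 1 := by
    rw [Complex.norm_exp]; simp
  simp [modBump, h2]

theorem fourierInv_modBump {N : ℕ} {α : ℝ} (hα : 0 < α) (a w : Fin N → ℂ)
    (hw : ∀ k, (w k).re ≠ 0) (p : ℤ × ℤ) (t : ℝ) :
    -(2 * Real.pi * I) * 𝓕⁻ (modBump α a w p) t =
      symbol α w t * timeFreqShift (α * p.1) (1 * p.2) (window a w) t := by
  have h1 := integral_sub_right_eq_self (μ := (volume : Measure ℝ))
    (fun ξ : ℝ => exp (2 * Real.pi * I * p.2 * t) *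
      (exp (2 * Real.pi * I * ξ * (t - α * p.1 : ℝ)) * bump α a w ξ)) (p.2 : ℝ)
  have h2 : 𝓕⁻ (modBump α a w p) t = ∫ ξ : ℝ, exp (2 * Real.pi * I * p.2 * t) *
      (exp (2 * Real.pi * I * (ξ - p.2 : ℝ) * (t - α * p.1 : ℝ)) * bump α a w (ξ - p.2)) := by
    rw [Real.fourierInv_eq']
    congr 1 with ξ
    rw [modBump, smul_eq_mul, ← mul_assoc, ← mul_assoc (exp (2 * Real.pi * I * p.2 * t)),
      ← Complex.exp_add, ← Complex.exp_add]
    congr 2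
    simp only [RCLike.inner_apply, conj_trivial]
    push_cast
    ring
  rw [h2, h1, integral_const_mul, timeFreqShift, ← symbol_sub_mul hα.ne' w t p.1]
  have h3 := integral_exp_mul_bump hα a w hw (t - α * p.1)
  push_cast at h3 ⊢
  rw [one_mul]
  linear_combination exp (2 * Real.pi * I * p.2 * t) * h3

/-! ### Frame coefficients and frame sums -/

theorem enorm_inner_gaborSystem {N : ℕ} {α : ℝ} (hα : 0 < α) (a w : Fin N → ℂ)
    (hw : ∀ k, (w k).re ≠ 0) (p : ℤ × ℤ) {f f' : Lp ℂ 2 (volume : Measure ℝ)}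
    (hf : f =ᵐ[volume] fun t => conj (symbol α w t) * f' t) {G : ℝ → ℂ}
    (hG : G =ᵐ[volume] fun ξ => conj ((𝓕 f' : Lp ℂ 2 (volume : Measure ℝ)) ξ)) :
    ‖inner ℂ (gaborSystem (window a w) (memLp_window a w hw) α 1 p) f‖ₑ =
      ENNReal.ofReal (2 * Real.pi) * ‖∫ ξ, G ξ * modBump α a w p ξ‖ₑ := by
  set S := (memLp_modBump α a w p 2).toLp
  have hint : Integrable (modBump α a w p) := memLp_one_iff_integrable.1 (memLp_modBump α a w p 1)
  have hpi : (Real.pi : ℂ) ≠ 0 := by exact_mod_cast Real.pi_ne_zero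
  have hπ := memLp_timeFreqShift (memLp_window a w hw) (α * p.1) (1 * p.2)
  obtain ⟨c, C, -, -, hcC⟩ := exists_symbol_bounds hα.ne' hw
  have hv : MemLp (fun t => (-(2 * Real.pi * I))⁻¹ *
      (symbol α w t * timeFreqShift (α * p.1) (1 * p.2) (window a w) t)) 2 volume := by
    refine MemLp.const_mul ?_ _
    refine hπ.of_le_mul (c := C)
      ((continuous_symbol α w).aestronglyMeasurable.mul hπ.1) (Filter.Eventually.of_forall fun t => ?_)
    rw [norm_mul]
    exact mul_le_mul_of_nonneg_right (hcC t).2 (norm_nonneg _)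
  have hinv := fourierInv_toLp hint (memLp_modBump α a w p 2) hv fun t => by
    rw [← fourierInv_modBump hα a w hw p t, inv_mul_cancel_left₀]
    simp [hpi, I_ne_zero]
  -- The conjugated symbol passes from `f` to the other argument, where it multiplies the shifted
  -- window.
  have h1 : inner ℂ (gaborSystem (window a w) (memLp_window a w hw) α 1 p) f =
      inner ℂ ((-(2 * Real.pi * I)) • (𝓕⁻ S : Lp ℂ 2 (volume : Measure ℝ))) f' := by
    rw [hinv, L2.inner_def, L2.inner_def]
    refine integral_congr_ae ?_
    filter_upwards [hf, hv.coeFn_toLp, hπ.coeFn_toLp,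
      Lp.coeFn_smul (-(2 * Real.pi * I)) (hv.toLp _)] with t h2 h3 h4 h5
    rw [gaborSystem, h4, h5, h2, Pi.smul_apply, h3, smul_eq_mul, mul_inv_cancel_left₀
      (by simp [hpi, I_ne_zero])]
    simp only [RCLike.inner_apply, map_mul]
    ring
  have h2 : inner ℂ (𝓕⁻ S : Lp ℂ 2 (volume : Measure ℝ)) f' = inner ℂ S (𝓕 f') := by
    rw [← Lp.inner_fourier_eq, fourier_fourierInv_eq]
  have h3 : inner ℂ (𝓕 f') S = ∫ ξ, G ξ * modBump α a w p ξ := by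
    rw [L2.inner_def]
    refine integral_congr_ae ?_
    filter_upwards [hG, (memLp_modBump α a w p 2).coeFn_toLp] with ξ h4 h5
    rw [h4, h5, RCLike.inner_apply, mul_comm]
  rw [h1, inner_smul_left, h2, ← inner_conj_symm, h3, enorm_mul, ← ofReal_norm, RCLike.norm_conj]
  congr 1
  · simp [abs_of_pos Real.pi_pos]
  · rw [← ofReal_norm, RCLike.norm_conj, ofReal_norm]

theorem memLp_comp_add_mul_multiplier {N : ℕ} (α : ℝ) (a w : Fin N → ℂ) {G : ℝ → ℂ}
    (hG : MemLp G 2 volume) (s : ℕ) (y : ℝ) :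
    MemLp (fun x => G (x + y) * multiplier α a w s x) 2
      (volume.restrict (Set.Ioc 0 (1 / α))) := by
  have h1 : MemLp (fun x => G (x + y)) 2 (volume.restrict (Set.Ioc 0 (1 / α))) :=
    (hG.comp_measurePreserving (measurePreserving_add_right volume y)).restrict _
  have h2 := (memLp_indicator_iff_restrict measurableSet_Ioc).1
    (memLp_indicator_multiplier α a w s ∞)
  exact h2.mul h1

theorem integral_mul_modBump {N : ℕ} (α : ℝ) (a w : Fin N → ℂ) {G : ℝ → ℂ}
    (hα : 0 < α) (hG : MemLp G 2 volume) (p : ℤ × ℤ) :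
    ∫ ξ, G ξ * modBump α a w p ξ =
      ∫ x in Set.Ioc 0 (1 / α), exp (-(2 * Real.pi * I * p.1 * x / (1 / α : ℝ))) *
        ∑ s ∈ Finset.range N, G (x + p.2 + s / α) * multiplier α a w s x := by
  have hα' : (α : ℂ) ≠ 0 := by exact_mod_cast hα.ne'
  set e : ℝ → ℂ := fun x => exp (-(2 * Real.pi * I * (α * p.1) * x)) with he
  have he1 : ∀ x, ‖e x‖ = 1 := fun x => by rw [he, Complex.norm_exp]; simp
  have hec : Continuous e := by fun_prop
  -- `e` has period 1/α, so after substituting ξ = x + n + s/α every s carries the same character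
  -- and the pieces fold onto one interval.
  have hshift : ∀ (s : ℕ) (x : ℝ), e (x + s / α) = e x := fun s x => by
    simp only [he]
    rw [← Complex.exp_periodic.sub_int_mul_eq (s * p.1) (x := -(2 * Real.pi * I * (α * p.1) * x))]
    congr 1
    push_cast
    field_simp
    ring
  have hterm : ∀ s : ℕ, Integrable fun ξ => G ξ * (e (ξ - p.2) *
      (Set.Ioc 0 (1 / α)).indicator (multiplier α a w s) (ξ - p.2 - s / α)) := fun s => by
    refine MemLp.integrable_mul (p := 2) (q := 2) hG ?_
    have h1 : MemLp (fun ξ =>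
        (Set.Ioc 0 (1 / α)).indicator (multiplier α a w s) (ξ - p.2 - s / α)) 2 volume :=
      ((memLp_indicator_multiplier α a w s 2).comp_measurePreserving
        (measurePreserving_sub_right volume (s / α : ℝ))).comp_measurePreserving
        (measurePreserving_sub_right volume (p.2 : ℝ))
    refine h1.of_le ((hec.comp (continuous_sub_right _)).aestronglyMeasurable.mul h1.1)
      (Filter.Eventually.of_forall fun ξ => ?_)
    rw [norm_mul]
    simp [he1]
  have h1 : ∀ ξ, G ξ * modBump α a w p ξ = ∑ s ∈ Finset.range N, G ξ * (e (ξ - p.2) *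
      (Set.Ioc 0 (1 / α)).indicator (multiplier α a w s) (ξ - p.2 - s / α)) := fun ξ => by
    rw [modBump, bump, Finset.mul_sum, Finset.mul_sum]
    simp [he]
  simp_rw [h1, Finset.mul_sum]
  rw [integral_finsetSum _ fun s _ => hterm s, integral_finsetSum]
  · refine Finset.sum_congr rfl fun s _ => ?_
    rw [← integral_indicator measurableSet_Ioc,
      ← integral_add_right_eq_self _ (p.2 + s / α : ℝ)]
    congr 1 with x
    have h2 : x + (p.2 + s / α) - p.2 - s / α = x := by ring
    have h3 : x + (p.2 + s / α) - p.2 = x + s / α := by ring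
    have h4 : e x = exp (-(2 * Real.pi * I * p.1 * x / (1 / α : ℝ))) := by
      simp only [he]
      congr 1
      push_cast
      field_simp
    rw [h2, h3, hshift, ← add_assoc]
    by_cases hx : x ∈ Set.Ioc 0 (1 / α)
    · rw [Set.indicator_of_mem hx, Set.indicator_of_mem hx, h4]
      ring
    · rw [Set.indicator_of_notMem hx, Set.indicator_of_notMem hx, mul_zero, mul_zero]
  · intro s _
    have h2 : Integrable (fun x => G (x + (p.2 + s / α)) * multiplier α a w s x)
        (volume.restrict (Set.Ioc 0 (1 / α))) :=
      (memLp_comp_add_mul_multiplier α a w hG s (p.2 + s / α)).integrable one_le_two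
    simp_rw [← add_assoc] at h2
    refine h2.bdd_mul (c := 1) (by fun_prop : Continuous _).aestronglyMeasurable
      (Filter.Eventually.of_forall fun ξ => ?_)
    rw [Complex.norm_exp]
    simp

theorem tsum_enorm_sq_inner_gaborSystem {N : ℕ} {α : ℝ} (hα : 0 < α) (a w : Fin N → ℂ)
    (hw : ∀ k, (w k).re ≠ 0) {f f' G : Lp ℂ 2 (volume : Measure ℝ)}
    (hf : f =ᵐ[volume] fun t => conj (symbol α w t) * f' t)
    (hG : G =ᵐ[volume] fun ξ => conj ((𝓕 f' : Lp ℂ 2 (volume : Measure ℝ)) ξ)) :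
    ∑' p, ‖inner ℂ (gaborSystem (window a w) (memLp_window a w hw) α 1 p) f‖ₑ ^ 2 =
      ENNReal.ofReal ((2 * Real.pi) ^ 2 / α) * criterionForm α a w G := by
  have hα' : 0 < 1 / α := by positivity
  have hH : ∀ n : ℤ, MemLp (fun x => ∑ s ∈ Finset.range N,
      G (x + n + s / α) * multiplier α a w s x) 2 (volume.restrict (Set.Ioc 0 (1 / α))) := by
    intro n
    refine memLp_finsetSum _ fun s _ => ?_
    simpa only [add_assoc] using memLp_comp_add_mul_multiplier α a w (Lp.memLp G) s (n + s / α)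
  simp_rw [enorm_inner_gaborSystem hα a w hw _ hf hG,
    integral_mul_modBump α a w hα (Lp.memLp G), mul_pow (ENNReal.ofReal _)]
  -- The translation index m becomes the inner sum, to which Parseval with T = 1/α applies.
  rw [ENNReal.tsum_mul_left, ENNReal.tsum_prod', ENNReal.tsum_comm]
  simp_rw [fun n : ℤ => tsum_enorm_sq_fourierIntegral hα' (hH n)]
  rw [ENNReal.tsum_mul_left, criterionForm, lintegral_tsum, ← mul_assoc,
    ← ENNReal.ofReal_pow (by positivity), ← ENNReal.ofReal_mul (by positivity), mul_one_div]
  intro n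
  rw [Measure.restrict_congr_set Ioo_ae_eq_Ioc]
  exact (hH n).1.enorm.pow_const 2

/-! ### Comparison of norms and transfer of the bounds -/

theorem ofReal_tsum_norm_sq {ι E : Type*} [NormedAddCommGroup E] {v : ι → E}
    (hv : Summable fun i => ‖v i‖ ^ 2) :
    ENNReal.ofReal (∑' i, ‖v i‖ ^ 2) = ∑' i, ‖v i‖ₑ ^ 2 := by
  rw [ENNReal.ofReal_tsum_of_nonneg (fun i => sq_nonneg _) hv]
  simp_rw [ENNReal.ofReal_pow (norm_nonneg _), ofReal_norm]

theorem summable_norm_sq_of_tsum_enorm_ne_top {ι E : Type*} [NormedAddCommGroup E] {v : ι → E}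
    (hv : ∑' i, ‖v i‖ₑ ^ 2 ≠ ∞) : Summable fun i => ‖v i‖ ^ 2 := by
  simpa using ENNReal.summable_toReal hv

/-- Multiplication of a square integrable function by a measurable function bounded above and
below. -/
theorem exists_Lp_eq_mul {u : ℝ → ℂ} (hu : AEStronglyMeasurable u volume) {c C : ℝ} (hc : 0 < c)
    (huc : ∀ t, c ≤ ‖u t‖) (huC : ∀ t, ‖u t‖ ≤ C) (f : Lp ℂ 2 (volume : Measure ℝ)) :
    ∃ f' : Lp ℂ 2 (volume : Measure ℝ), f' =ᵐ[volume] (fun t => u t * f t) ∧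
      c * ‖f‖ ≤ ‖f'‖ ∧ ‖f'‖ ≤ C * ‖f‖ := by
  have hm : MemLp (fun t => u t * f t) 2 volume := by
    refine (Lp.memLp f).of_le_mul (c := C) (hu.mul (Lp.memLp f).1)
      (Filter.Eventually.of_forall fun t => ?_)
    rw [norm_mul]
    exact mul_le_mul_of_nonneg_right (huC t) (norm_nonneg _)
  refine ⟨hm.toLp, hm.coeFn_toLp, ?_, ?_⟩
  · rw [← le_inv_mul_iff₀ hc]
    refine Lp.norm_le_mul_norm_of_ae_le_mul ?_
    filter_upwards [hm.coeFn_toLp] with t ht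
    rw [ht, le_inv_mul_iff₀ hc, norm_mul]
    exact mul_le_mul_of_nonneg_right (huc t) (norm_nonneg _)
  · refine Lp.norm_le_mul_norm_of_ae_le_mul ?_
    filter_upwards [hm.coeFn_toLp] with t ht
    rw [ht, norm_mul]
    exact mul_le_mul_of_nonneg_right (huC t) (norm_nonneg _)

theorem norm_eq_of_ae_eq_conj {f g : Lp ℂ 2 (volume : Measure ℝ)}
    (h : f =ᵐ[volume] fun t => conj (g t)) : ‖f‖ = ‖g‖ := by
  rw [Lp.norm_def, Lp.norm_def]
  congr 1
  refine eLpNorm_congr_norm_ae ?_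
  filter_upwards [h] with t ht
  rw [ht, RCLike.norm_conj]

/-- The frame sums of the Gabor system and the form of the criterion agree up to a constant, under
a correspondence of `L²(ℝ)` with itself that changes norms by bounded factors. -/
theorem exists_correspondence {N : ℕ} {α : ℝ} (hα : 0 < α) (a w : Fin N → ℂ)
    (hw : ∀ k, (w k).re ≠ 0) :
    ∃ c C : ℝ, 0 < c ∧ 0 < C ∧ ∃ R : Lp ℂ 2 (volume : Measure ℝ) → Lp ℂ 2 (volume : Measure ℝ) →
        Prop, (∀ f, ∃ G, R f G) ∧ (∀ G, ∃ f, R f G) ∧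
      ∀ f G, R f G → c * ‖G‖ ≤ ‖f‖ ∧ ‖f‖ ≤ C * ‖G‖ ∧
        ∑' p, ‖inner ℂ (gaborSystem (window a w) (memLp_window a w hw) α 1 p) f‖ₑ ^ 2 =
          ENNReal.ofReal ((2 * Real.pi) ^ 2 / α) * criterionForm α a w G := by
  obtain ⟨c, C, hc, hC, hcC⟩ := exists_symbol_bounds hα.ne' hw
  have hcont : Continuous fun t => conj (symbol α w t) :=
    Complex.continuous_conj.comp (continuous_symbol α w)
  have hcC' : ∀ t, c ≤ ‖conj (symbol α w t)‖ ∧ ‖conj (symbol α w t)‖ ≤ C := fun t => by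
    rw [RCLike.norm_conj]
    exact hcC t
  have hne : ∀ t, conj (symbol α w t) ≠ 0 := fun t =>
    norm_pos_iff.1 (hc.trans_le (hcC' t).1)
  refine ⟨c, C, hc, hC, fun f G => ∃ f' : Lp ℂ 2 (volume : Measure ℝ),
    f =ᵐ[volume] (fun t => conj (symbol α w t) * f' t) ∧
    G =ᵐ[volume] (fun ξ => conj ((𝓕 f' : Lp ℂ 2 (volume : Measure ℝ)) ξ)) ∧
    c * ‖f'‖ ≤ ‖f‖ ∧ ‖f‖ ≤ C * ‖f'‖, fun f => ?_, fun G => ?_, ?_⟩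
  · obtain ⟨f', hf', h1, h2⟩ := exists_Lp_eq_mul (u := fun t => (conj (symbol α w t))⁻¹)
      (C := c⁻¹) (hcont.inv₀ hne).aestronglyMeasurable (inv_pos.2 hC) (fun t => by
        rw [norm_inv]
        exact inv_anti₀ (norm_pos_iff.2 (hne t)) (hcC' t).2)
      (fun t => by
        rw [norm_inv]
        exact inv_anti₀ hc (hcC' t).1) f
    refine ⟨star (𝓕 f'), f', ?_, Lp.coeFn_star _, ?_, ?_⟩
    · filter_upwards [hf'] with t ht
      rw [ht, mul_inv_cancel_left₀ (hne t)]
    · rwa [← le_inv_mul_iff₀ hc]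
    · rwa [← inv_mul_le_iff₀ hC]
  · obtain ⟨f, hf, h1, h2⟩ := exists_Lp_eq_mul hcont.aestronglyMeasurable hc
      (fun t => (hcC' t).1) (fun t => (hcC' t).2) (𝓕⁻ (star G) : Lp ℂ 2 (volume : Measure ℝ))
    refine ⟨f, 𝓕⁻ (star G), hf, ?_, h1, h2⟩
    rw [fourier_fourierInv_eq]
    filter_upwards [Lp.coeFn_star G] with t ht
    rw [ht]
    simp
  · rintro f G ⟨f', hf, hG, h1, h2⟩
    rw [norm_eq_of_ae_eq_conj hG, Lp.norm_fourier_eq]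
    exact ⟨h1, h2, tsum_enorm_sq_inner_gaborSystem hα a w hw hf hG⟩

end RationalGabor

theorem mainTheorem9 {N : ℕ} (a w : Fin N → ℂ) (ha : ∀ k, a k ≠ 0)
    (hw : ∀ k, (w k).re ≠ 0) (α : ℝ) (hα : 0 < α) (hα1 : α ≤ 1) :
    RationalGabor.IsFrame
        (RationalGabor.gaborSystem (RationalGabor.window a w)
          (RationalGabor.memLp_window a w hw) α 1) ↔
      ∃ c C : ℝ, 0 < c ∧ 0 < C ∧ ∀ G : Lp ℂ 2 (volume : Measure ℝ),
        ENNReal.ofReal (c * ‖G‖ ^ 2) ≤ RationalGabor.criterionForm α a w G ∧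
        RationalGabor.criterionForm α a w G ≤ ENNReal.ofReal (C * ‖G‖ ^ 2) := by
  obtain ⟨c, C, hc, hC, R, hR1, hR2, hR⟩ := RationalGabor.exists_correspondence hα a w hw
  have hK : 0 < (2 * Real.pi) ^ 2 / α := by positivity
  generalize (2 * Real.pi) ^ 2 / α = K at hR hK
  have hK0 : ENNReal.ofReal K ≠ 0 := by simpa using hK
  have hmul : ∀ x y : ℝ≥0∞, ENNReal.ofReal K * x ≤ ENNReal.ofReal K * y ↔ x ≤ y := fun x y =>
    ENNReal.mul_le_mul_iff_right hK0 ENNReal.ofReal_ne_top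
  constructor
  · rintro ⟨A, B, hA, hAB⟩
    -- K · form equals the frame sum, and c‖G‖ ≤ ‖f‖ ≤ C‖G‖. No sign of `B` is known, hence |B|; the
    -- + 1 makes the constant positive.
    refine ⟨A * c ^ 2 / K, |B| * C ^ 2 / K + 1, by positivity, by positivity, fun G => ?_⟩
    obtain ⟨f, hf⟩ := hR2 G
    obtain ⟨h1, h2, h3⟩ := hR f G hf
    obtain ⟨hs, h4, h5⟩ := hAB f
    rw [← RationalGabor.ofReal_tsum_norm_sq hs] at h3
    have hG := norm_nonneg G
    have h1' : (c * ‖G‖) ^ 2 ≤ ‖f‖ ^ 2 := pow_le_pow_left₀ (by positivity) h1 2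
    have h2' : ‖f‖ ^ 2 ≤ (C * ‖G‖) ^ 2 := pow_le_pow_left₀ (norm_nonneg _) h2 2
    constructor
    · rw [← hmul, ← h3, ← ENNReal.ofReal_mul hK.le]
      refine ENNReal.ofReal_le_ofReal ((le_of_eq ?_).trans
        ((mul_le_mul_of_nonneg_left h1' hA.le).trans h4))
      field_simp
    · rw [← hmul, ← h3, ← ENNReal.ofReal_mul hK.le]
      refine ENNReal.ofReal_le_ofReal (h5.trans ?_)
      have h6 : B * ‖f‖ ^ 2 ≤ |B| * (C * ‖G‖) ^ 2 :=
        mul_le_mul (le_abs_self B) h2' (sq_nonneg _) (abs_nonneg _)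
      have h7 : K * ((|B| * C ^ 2 / K + 1) * ‖G‖ ^ 2) =
          |B| * (C * ‖G‖) ^ 2 + K * ‖G‖ ^ 2 := by
        field_simp
      rw [h7]
      exact h6.trans (le_add_of_nonneg_right (by positivity))
  · rintro ⟨A, B, hA, hB, hAB⟩
    refine ⟨A * K / C ^ 2, B * K / c ^ 2, by positivity, fun f => ?_⟩
    obtain ⟨G, hG⟩ := hR1 f
    obtain ⟨h1, h2, h3⟩ := hR f G hG
    obtain ⟨h4, h5⟩ := hAB G
    rw [← hmul, ← h3, ← ENNReal.ofReal_mul hK.le] at h4 h5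
    -- The upper bound makes the extended sum finite, which supplies the summability required of a
    -- frame.
    have hs := RationalGabor.summable_norm_sq_of_tsum_enorm_ne_top
      (h5.trans_lt ENNReal.ofReal_lt_top).ne
    rw [← RationalGabor.ofReal_tsum_norm_sq hs] at h4 h5
    rw [ENNReal.ofReal_le_ofReal_iff (tsum_nonneg fun i => sq_nonneg _)] at h4
    rw [ENNReal.ofReal_le_ofReal_iff (by positivity)] at h5
    have h1' : (c * ‖G‖) ^ 2 ≤ ‖f‖ ^ 2 := pow_le_pow_left₀ (by positivity) h1 2
    have h2' : ‖f‖ ^ 2 ≤ (C * ‖G‖) ^ 2 := pow_le_pow_left₀ (norm_nonneg _) h2 2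
    refine ⟨hs, le_trans ?_ h4, h5.trans ?_⟩
    · rw [div_mul_eq_mul_div, div_le_iff₀ (by positivity)]
      refine (mul_le_mul_of_nonneg_left h2' (by positivity)).trans_eq ?_
      ring
    · rw [div_mul_eq_mul_div, le_div_iff₀ (by positivity)]
      refine le_trans (le_of_eq ?_) (mul_le_mul_of_nonneg_left h1' (by positivity))
      ring
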